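/- Graphs are finite and loopless, and may have multiple edges. For a set $F$ of edges of a graph $G$, let $G[F]$ be the graph with edge set $F$ whose vertices are the ends of the edges in $F$. A graph is \emph{2-connected} if it is connected, has at least two vertices, and there is no partition of its edge set into nonempty sets $E_1,E_2$ such that $G[E_1]$ and $G[E_2]$ have exactly one vertex in common. A graph $H$ is \emph{connected modulo $[u,v]$} if there is no partition of its edge set into nonempty sets $F_1,F_2$ such that every common vertex of $H[F_1]$ and $H[F_2]$ lies in $\{u,v\}$. A \emph{split candidate} $\{E_1,E_2,u,v\}$ of $H$ is a partition of $E(H)$ into two sets $E_1,E_2$ with at least two edges each, such that the common vertices of $H[E_1]$ and $H[E_2]$ are exactly two distinct vertices $u,v$, the graph $H[E_1]$ is connected modulo $[u,v]$, and $H[E_2]$ is 2-connected. The corresponding \emph{split operation} replaces $H$ by the two graphs $H[E_1]+e$ and $H[E_2]+e$, where $e$ is a new edge joining $u$ and $v$, called a \emph{virtual edge}. A \emph{brick decomposition} of $G$ is a collection of graphs (\emph{bricks}) obtained from $\{G\}$ by finitely many split operations, none of which has a split candidate. Its \emph{RMT-tree} is the graph whose nodes are the bricks and whose edges are the virtual edges,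 each virtual edge joining the two bricks that contain it. For a vertex $v$ of $G$, the \emph{restricted RMT-tree} at $v$ is the subgraph of the RMT-tree induced by the bricks that contain $v$. \textbf{Lemma.} Let $G$ be a 2-connected graph with at least 3 edges and let $v$ be a vertex of $G$. Then $G$ has a brick decomposition, and for every brick decomposition of $G$ (whatever split operations were chosen) the restricted RMT-tree at $v$ is a tree, that is, a nonempty connected graph without cycles. -/

import Mathlib

namespace Graph

/-! ### Connectivity of multigraphs -/

/-- `G[F]`: the graph whose edge set is `F` (a set of edges of `G`) and whose vertices are the
ends of the edges in `F`. -/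
def edgeInduce {α β : Type*} (G : Graph α β) (F : Set β) : Graph α β where
  vertexSet := {x | ∃ e ∈ F, G.Inc e x}
  IsLink e x y := e ∈ F ∧ G.IsLink e x y
  isLink_symm _ _ := ⟨fun _ _ h => ⟨h.1, h.2.symm⟩⟩
  eq_or_eq_of_isLink_of_isLink _ _ _ _ _ h h' := h.2.left_eq_or_eq h'.2
  left_mem_of_isLink e _ y h := ⟨e, h.1, y, h.2⟩

/-- `E₁, E₂` is a partition of the edge set of `G` into two parts (possibly empty). -/
def IsEdgePartition {α β : Type*} (G : Graph α β) (E₁ E₂ : Set β) : Prop :=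
  E₁ ∪ E₂ = G.edgeSet ∧ Disjoint E₁ E₂

/-- A 1-separator: a partition of the edge set into two nonempty sets `E₁, E₂` such that
`G[E₁]` and `G[E₂]` have exactly one common vertex. -/
def IsOneSeparator {α β : Type*} (G : Graph α β) (E₁ E₂ : Set β) : Prop :=
  G.IsEdgePartition E₁ E₂ ∧ E₁.Nonempty ∧ E₂.Nonempty ∧
    ∃ v, (G.edgeInduce E₁).vertexSet ∩ (G.edgeInduce E₂).vertexSet = {v}

/-- A graph is 2-connected if it is connected, has at least two vertices and no 1-separator. -/
def TwoConnected {α β : Type*} (G : Graph α β) : Prop :=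
  G.toSimpleGraph.Connected ∧ 2 ≤ G.vertexSet.encard ∧ ∀ E₁ E₂, ¬ G.IsOneSeparator E₁ E₂

/-- A 2-separator with separating vertex pair `{u, v}`: a partition of the edge set into two sets
`E₁, E₂` of cardinality at least 2 such that the common vertices of `G[E₁]` and `G[E₂]`
are the two vertices `u ≠ v`. -/
def IsTwoSeparator {α β : Type*} (G : Graph α β) (E₁ E₂ : Set β) (u v : α) : Prop :=
  G.IsEdgePartition E₁ E₂ ∧ 2 ≤ E₁.encard ∧ 2 ≤ E₂.encard ∧ u ≠ v ∧
    (G.edgeInduce E₁).vertexSet ∩ (G.edgeInduce E₂).vertexSet = {u, v}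

/-- `G` is connected modulo `[u, v]`: there is no partition of the edge set into two nonempty
sets `E₁, E₂` such that `G[E₁]` and `G[E₂]` intersect only at `u` and `v`. -/
def ConnectedModulo {α β : Type*} (G : Graph α β) (u v : α) : Prop :=
  ¬ ∃ E₁ E₂, G.IsEdgePartition E₁ E₂ ∧ E₁.Nonempty ∧ E₂.Nonempty ∧
    (G.edgeInduce E₁).vertexSet ∩ (G.edgeInduce E₂).vertexSet ⊆ {u, v}

/-! ### Split decomposition -/

/-- `{E₁, E₂, u, v}` is a split candidate of `G`: a 2-separator with separating vertex pair
`{u, v}` such that `G[E₁]` is connected modulo `[u, v]` and `G[E₂]` is 2-connected. -/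
def IsSplitCandidate {α β : Type*} (G : Graph α β) (E₁ E₂ : Set β) (u v : α) : Prop :=
  G.IsTwoSeparator E₁ E₂ u v ∧ (G.edgeInduce E₁).ConnectedModulo u v ∧
    (G.edgeInduce E₂).TwoConnected

/-- The graph obtained from `G` by adding an edge labelled `e` between `u` and `v`.
(Only used when `e` is not an edge of `G`.) -/
def addEdge {α β : Type*} (G : Graph α β) (e : β) (u v : α) : Graph α β where
  vertexSet := G.vertexSet ∪ {u, v}
  IsLink f x y := (f ≠ e ∧ G.IsLink f x y) ∨ (f = e ∧ (x = u ∧ y = v ∨ x = v ∧ y = u))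
  isLink_symm _ _ := ⟨by
    rintro x y (⟨h, h'⟩ | ⟨h, h'⟩)
    · exact Or.inl ⟨h, h'.symm⟩
    · exact Or.inr ⟨h, by tauto⟩⟩
  eq_or_eq_of_isLink_of_isLink := by
    rintro f x y z w (⟨h, h'⟩ | ⟨h, h'⟩) (⟨k, k'⟩ | ⟨k, k'⟩)
    · exact h'.left_eq_or_eq k'
    · exact absurd k h
    · exact absurd h k
    · grind
  left_mem_of_isLink := by
    rintro f x y (⟨-, h⟩ | ⟨-, h⟩)
    · exact Or.inl h.left_mem
    · exact Or.inr (by rcases h with h | h <;> simp [h.1])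

/-- `G` with its edges relabelled by `Sum.inl`. In a `Graph α (β ⊕ ℕ)`, edges labelled
`Sum.inl e` are real edges and edges labelled `Sum.inr n` are virtual edges. -/
def realEdges {α β : Type*} (G : Graph α β) : Graph α (β ⊕ ℕ) where
  vertexSet := G.vertexSet
  IsLink f x y := ∃ e, f = Sum.inl e ∧ G.IsLink e x y
  isLink_symm _ _ := ⟨fun _ _ ⟨e, h, h'⟩ => ⟨e, h, h'.symm⟩⟩
  eq_or_eq_of_isLink_of_isLink := by
    rintro _ x y z w ⟨e, rfl, h⟩ ⟨e', he, h'⟩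
    obtain rfl := Sum.inl.inj he
    exact h.left_eq_or_eq h'
  left_mem_of_isLink := by
    rintro _ x y ⟨e, -, h⟩
    exact h.left_mem

/-- One split operation on a collection `S` of graphs: some `H ∈ S` with a split candidate
`{E₁, E₂, u, v}` is replaced by the two graphs `H[E₁] + e` and `H[E₂] + e`, where `e` is a
new virtual edge (with an unused label) between `u` and `v`. -/
def SplitStep {α β : Type*} (S S' : Set (Graph α (β ⊕ ℕ))) : Prop :=
  ∃ H ∈ S, ∃ (E₁ E₂ : Set (β ⊕ ℕ)) (u v : α) (n : ℕ),
    H.IsSplitCandidate E₁ E₂ u v ∧ (∀ K ∈ S, Sum.inr n ∉ K.edgeSet) ∧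
    S' = (S \ {H}) ∪
      {(H.edgeInduce E₁).addEdge (Sum.inr n) u v, (H.edgeInduce E₂).addEdge (Sum.inr n) u v}

/-- `S` is the collection of bricks of `G` obtained by some maximal sequence of split operations:
it arises from `{G}` by finitely many split operations, and none of its members has a
split candidate. -/
def IsBrickDecomposition {α β : Type*} (G : Graph α β) (S : Set (Graph α (β ⊕ ℕ))) : Prop :=
  Relation.ReflTransGen SplitStep {G.realEdges} S ∧
    ∀ H ∈ S, ∀ E₁ E₂ u v, ¬ H.IsSplitCandidate E₁ E₂ u v

/-- The RMT-tree of a collection `S` of bricks, as a multigraph: its nodes are the bricks, its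
edges are the virtual edges, and the virtual edge `n` links the two bricks that contain it. -/
def rmtTree {α β : Type*} (S : Set (Graph α (β ⊕ ℕ))) : Graph (Graph α (β ⊕ ℕ)) ℕ where
  vertexSet := S
  IsLink n A B := {C ∈ S | Sum.inr n ∈ C.edgeSet} = {A, B}
  isLink_symm _ _ := ⟨fun _ _ h => h.trans (Set.pair_comm _ _)⟩
  eq_or_eq_of_isLink_of_isLink := by
    intro n A B C D h h'
    have hA : A ∈ ({A, B} : Set (Graph α (β ⊕ ℕ))) := by simp
    rw [← h, h'] at hA
    simpa using hA
  left_mem_of_isLink := by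
    intro n A B h
    have hA : A ∈ ({A, B} : Set (Graph α (β ⊕ ℕ))) := by simp
    rw [← h] at hA
    exact hA.1

/-- The restricted RMT-tree at the vertex `v`: the subgraph of the RMT-tree induced by the
bricks containing `v`. -/
def restrictedRMTTree {α β : Type*} (S : Set (Graph α (β ⊕ ℕ))) (v : α) :
    Graph (Graph α (β ⊕ ℕ)) ℕ :=
  (rmtTree S).induce {B ∈ S | v ∈ B.vertexSet}

/-- A multigraph is a tree if it has neither loops nor parallel edges and, as a simple graph,
is a tree (nonempty, connected and acyclic). -/
def IsTree {α β : Type*} (T : Graph α β) : Prop :=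
  T.Simple ∧ T.toSimpleGraph.IsTree

end Graph

/-! A split expands one node of the RMT-tree into two nodes joined by the new virtual edge `n`;
contracting that edge gives the old tree back. At `v`, the split node becomes an edge if `v` lies in
both parts, and otherwise is replaced by the part containing `v`. The danger is that an old link
between two bricks containing `v` gets reattached to a part missing `v`. This cannot happen: two
graphs sharing a virtual edge meet only in its ends (`IsSplitCollection`), so `v` is an end of that
edge and stays in whichever part receives it.

The contraction is axiomatised as a map `φ` from new graphs to old ones (`IsSplitMap`). Connectivity
lifts along `φ` (`IsSplitMap.connected_restrictedRMTTree`), and the bound |E| + 1 ≤ |V| survives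
(`IsSplitMap.encard_restrictedRMTTree_le`). Together these force a tree with no loops or parallel
edges, so cycles are never examined directly. Existence of a decomposition follows from a decreasing
measure (`SplitStep.splitMeasure_lt`). -/

/-! ### Connectivity and trees -/

/-- Connectivity lifts along a surjection with connected fibres that lifts adjacencies. -/
theorem SimpleGraph.Connected.of_surjective {V W : Type*} {G : SimpleGraph V} {G' : SimpleGraph W}
    (hG : G.Connected) (φ : W → V) (hφ : Function.Surjective φ)
    (hfib : ∀ x y, φ x = φ y → G'.Reachable x y)
    (hadj : ∀ a b, G.Adj a b → ∃ x y, φ x = a ∧ φ y = b ∧ G'.Reachable x y) : G'.Connected := by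
  have key : ∀ a b, G.Reachable a b → ∀ x y, φ x = a → φ y = b → G'.Reachable x y := by
    rintro a b ⟨w⟩
    induction w with
    | nil => exact fun x y hx hy => hfib x y (hx.trans hy.symm)
    | cons h _ ih =>
      intro x y hx hy
      obtain ⟨x', y', hx', hy', hr⟩ := hadj _ _ h
      exact ((hfib x x' (hx.trans hx'.symm)).trans hr).trans (ih y' y hy' hy)
  have : Nonempty W := by
    obtain ⟨a⟩ := hG.nonempty
    exact ⟨(hφ a).choose⟩
  exact ⟨fun x y => key _ _ (hG.preconnected (φ x) (φ y)) x y rfl rfl⟩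

namespace Graph

variable {α β : Type*}

/-- The unordered pair of ends of an edge. -/
noncomputable def ends (G : Graph α β) (e : G.edgeSet) : Sym2 G.vertexSet :=
  have h := exists_isLink_of_mem_edgeSet e.2
  s(⟨h.choose, h.choose_spec.choose_spec.left_mem⟩,
    ⟨h.choose_spec.choose, h.choose_spec.choose_spec.right_mem⟩)

theorem IsLink.ends_eq {G : Graph α β} {e : β} {x y : α} (h : G.IsLink e x y) :
    G.ends ⟨e, h.edge_mem⟩ = s(⟨x, h.left_mem⟩, ⟨y, h.right_mem⟩) := by
  have h' := (exists_isLink_of_mem_edgeSet h.edge_mem).choose_spec.choose_spec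
  refine Sym2.eq_iff.2 ?_
  rcases h.eq_and_eq_or_eq_and_eq h' with ⟨h1, h2⟩ | ⟨h1, h2⟩
  · exact Or.inl ⟨Subtype.ext h1.symm, Subtype.ext h2.symm⟩
  · exact Or.inr ⟨Subtype.ext h2.symm, Subtype.ext h1.symm⟩

/-- A finite connected multigraph with fewer edges than vertices is a tree. -/
theorem isTree_of_connected_of_encard_lt {T : Graph α β} (hc : T.toSimpleGraph.Connected)
    (hV : T.vertexSet.Finite) (hE : T.edgeSet.encard + 1 ≤ T.vertexSet.encard) : T.IsTree := by
  have hEfin : T.edgeSet.Finite := by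
    rw [← Set.encard_ne_top_iff]
    intro h
    rw [h, top_add, top_le_iff, Set.encard_eq_top_iff] at hE
    exact hE hV
  have : Finite T.vertexSet := hV
  have : Finite T.edgeSet := hEfin
  have hE' : Nat.card T.edgeSet + 1 ≤ Nat.card T.vertexSet := by
    rw [← hEfin.cast_ncard_eq, ← hV.cast_ncard_eq] at hE
    rw [Nat.card_coe_set_eq, Nat.card_coe_set_eq]
    exact_mod_cast hE
  have hsub : T.toSimpleGraph.edgeSet ⊆ Set.range T.ends := by
    intro e
    induction e with
    | h x y =>
      rintro ⟨-, f, hf⟩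
      exact ⟨⟨f, hf.edge_mem⟩, hf.ends_eq⟩
  -- The chain |V| ≤ |E(simple graph)| + 1 ≤ |range of `ends`| + 1 ≤ |E| + 1 ≤ |V| collapses to
  -- equalities. Equality in the middle excludes loops, and injectivity of `ends` excludes parallel
  -- edges.
  have h1 := hc.card_vert_le_card_edgeSet_add_one
  have h2 : Nat.card T.toSimpleGraph.edgeSet ≤ (Set.range T.ends).ncard := by
    rw [Nat.card_coe_set_eq]
    exact Set.ncard_le_ncard hsub
  have h3 : (Set.range T.ends).ncard ≤ Nat.card T.edgeSet := by
    rw [← Nat.card_coe_set_eq]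
    exact Finite.card_range_le _
  have hrange : T.toSimpleGraph.edgeSet = Set.range T.ends := by
    refine Set.eq_of_subset_of_ncard_le hsub ?_
    rw [← Nat.card_coe_set_eq T.toSimpleGraph.edgeSet]
    omega
  have hinj : Function.Injective T.ends := by
    have hs : Function.Surjective (Set.rangeFactorization T.ends) := Set.rangeFactorization_surjective
    have hb := (Nat.bijective_iff_surjective_and_card _).2 ⟨hs, by
      rw [Nat.card_coe_set_eq (Set.range T.ends)]; omega⟩
    exact (Set.rangeFactorization_injective).1 hb.1
  have hloop : T.Loopless := by
    refine ⟨fun e x h => ?_⟩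
    have hx : T.ends ⟨e, h.edge_mem⟩ ∈ T.toSimpleGraph.edgeSet := hrange ▸ Set.mem_range_self _
    rw [IsLink.ends_eq h] at hx
    exact hx.1 rfl
  refine ⟨⟨fun e f x y he hf => ?_⟩, SimpleGraph.isTree_iff_connected_and_card.2 ⟨hc, by omega⟩⟩
  exact congrArg Subtype.val (hinj (he.ends_eq.trans hf.ends_eq.symm))

/-! ### The two parts of a split -/

section Parts

variable {H : Graph α β} {E : Set β} {e : β} {u v : α}

theorem edgeSet_splitPart (hE : E ⊆ H.edgeSet) (he : e ∉ H.edgeSet) :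
    ((H.edgeInduce E).addEdge e u v).edgeSet = insert e E := by
  ext f
  constructor
  · rintro ⟨x, y, ⟨-, h, -⟩ | ⟨rfl, -⟩⟩
    · exact Or.inr h
    · exact Or.inl rfl
  · rintro (rfl | h)
    · exact ⟨u, v, Or.inr ⟨rfl, Or.inl ⟨rfl, rfl⟩⟩⟩
    · obtain ⟨x, y, hxy⟩ := exists_isLink_of_mem_edgeSet (hE h)
      exact ⟨x, y, Or.inl ⟨fun hf => he (hf ▸ hE h), h, hxy⟩⟩

theorem vertexSet_splitPart (huv : {u, v} ⊆ (H.edgeInduce E).vertexSet) :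
    ((H.edgeInduce E).addEdge e u v).vertexSet = (H.edgeInduce E).vertexSet :=
  Set.union_eq_left.2 huv

theorem vertexSet_edgeInduce_subset : (H.edgeInduce E).vertexSet ⊆ H.vertexSet :=
  fun _ ⟨_, _, h⟩ => h.vertex_mem

theorem Inc.splitPart {f : β} {x : α} (h : H.Inc f x) (hf : f ∈ E) (he : e ∉ H.edgeSet) :
    ((H.edgeInduce E).addEdge e u v).Inc f x := by
  obtain ⟨y, hy⟩ := h
  exact ⟨y, Or.inl ⟨fun hfe => he (hfe ▸ hy.edge_mem), hf, hy⟩⟩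

theorem inc_addEdge {x : α} (K : Graph α β) (hx : x ∈ ({u, v} : Set α)) :
    (K.addEdge e u v).Inc e x := by
  rcases hx with rfl | rfl
  · exact ⟨v, Or.inr ⟨rfl, Or.inl ⟨rfl, rfl⟩⟩⟩
  · exact ⟨u, Or.inr ⟨rfl, Or.inr ⟨rfl, rfl⟩⟩⟩

end Parts

/-! ### Collections of graphs arising from split operations -/

/-- A finite collection of finite graphs without isolated vertices in which two graphs sharing a
virtual edge have only the ends of this edge in common. -/
structure IsSplitCollection (S : Set (Graph α (β ⊕ ℕ))) : Prop where
  finite : S.Finite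
  finite_edgeSet : ∀ H ∈ S, H.edgeSet.Finite
  exists_inc : ∀ H ∈ S, ∀ x ∈ H.vertexSet, ∃ f, H.Inc f x
  inc_of_mem : ∀ A ∈ S, ∀ B ∈ S, A ≠ B → ∀ m, Sum.inr m ∈ A.edgeSet → Sum.inr m ∈ B.edgeSet →
    ∀ x ∈ A.vertexSet, x ∈ B.vertexSet → A.Inc (Sum.inr m) x

/-- The map `φ` sends each graph of `S'` to the graph of `S` that it comes from, where `S'` arises
from `S` by a split operation with virtual edge `n`. -/
structure IsSplitMap (S S' : Set (Graph α (β ⊕ ℕ))) (n : ℕ)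
    (φ : Graph α (β ⊕ ℕ) → Graph α (β ⊕ ℕ)) : Prop where
  map_mem : ∀ K ∈ S', φ K ∈ S
  vertexSet_subset : ∀ K ∈ S', K.vertexSet ⊆ (φ K).vertexSet
  exists_vertex : ∀ K ∈ S, ∀ x ∈ K.vertexSet, ∃ K' ∈ S', φ K' = K ∧ x ∈ K'.vertexSet
  edge_mem : ∀ K ∈ S', ∀ f ∈ K.edgeSet, f ≠ Sum.inr n → f ∈ (φ K).edgeSet
  exists_edge : ∀ K ∈ S, ∀ f ∈ K.edgeSet, ∃ K' ∈ S', φ K' = K ∧ f ∈ K'.edgeSet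
  inc : ∀ K ∈ S', ∀ f ∈ K.edgeSet, ∀ x, (φ K).Inc f x → K.Inc f x
  fresh : ∀ K ∈ S, Sum.inr n ∉ K.edgeSet
  exists_pair : ∃ A B, A ≠ B ∧ φ A = φ B ∧ {K ∈ S' | Sum.inr n ∈ K.edgeSet} = {A, B}
  eq_or_new : ∀ K ∈ S', ∀ K' ∈ S', φ K = φ K' →
    K = K' ∨ Sum.inr n ∈ K.edgeSet ∧ Sum.inr n ∈ K'.edgeSet
  eq_of_edge : ∀ K ∈ S', ∀ K' ∈ S', φ K = φ K' → ∀ f ∈ K.edgeSet, f ∈ K'.edgeSet →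
    f ≠ Sum.inr n → K = K'
  inc_new : ∀ K ∈ S', ∀ K' ∈ S', K ≠ K' → Sum.inr n ∈ K.edgeSet → Sum.inr n ∈ K'.edgeSet →
    ∀ x ∈ K.vertexSet, x ∈ K'.vertexSet → K.Inc (Sum.inr n) x

section SplitCandidate

variable {H : Graph α β} {E₁ E₂ : Set β} {u v : α}

theorem IsSplitCandidate.subset_left (h : H.IsSplitCandidate E₁ E₂ u v) : E₁ ⊆ H.edgeSet :=
  h.1.1.1 ▸ Set.subset_union_left

theorem IsSplitCandidate.subset_right (h : H.IsSplitCandidate E₁ E₂ u v) : E₂ ⊆ H.edgeSet :=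
  h.1.1.1 ▸ Set.subset_union_right

theorem IsSplitCandidate.inter_eq (h : H.IsSplitCandidate E₁ E₂ u v) :
    (H.edgeInduce E₁).vertexSet ∩ (H.edgeInduce E₂).vertexSet = {u, v} :=
  h.1.2.2.2.2

/-- Collections are sets, so equal parts would merge into one node. They differ because `E₁` is
nonempty and disjoint from `E₂`. -/
theorem IsSplitCandidate.splitPart_ne (h : H.IsSplitCandidate E₁ E₂ u v) {e : β}
    (he : e ∉ H.edgeSet) :
    (H.edgeInduce E₁).addEdge e u v ≠ (H.edgeInduce E₂).addEdge e u v := by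
  intro heq
  have h' := congrArg Graph.edgeSet heq
  rw [edgeSet_splitPart h.subset_left he, edgeSet_splitPart h.subset_right he] at h'
  have hne : E₁.Nonempty := by
    rw [← Set.encard_pos]
    exact lt_of_lt_of_le (by norm_num) h.1.2.1
  obtain ⟨f, hf⟩ := hne
  have hf' : f ∈ insert e E₂ := h' ▸ Or.inr hf
  rcases hf' with rfl | hf'
  · exact he (h.subset_left hf)
  · exact Set.disjoint_left.1 h.1.1.2 hf hf'

end SplitCandidate

open Classical in
/-- A split operation is described by the map sending both new graphs to the graph split. -/
theorem IsSplitCandidate.isSplitMap {S : Set (Graph α (β ⊕ ℕ))} {H : Graph α (β ⊕ ℕ)}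
    {E₁ E₂ : Set (β ⊕ ℕ)} {u v : α} {n : ℕ}
    (hS : ∀ H ∈ S, ∀ x ∈ H.vertexSet, ∃ f, H.Inc f x) (hH : H ∈ S)
    (h : H.IsSplitCandidate E₁ E₂ u v) (hn : ∀ K ∈ S, Sum.inr n ∉ K.edgeSet) :
    IsSplitMap S ((S \ {H}) ∪
      {(H.edgeInduce E₁).addEdge (Sum.inr n) u v, (H.edgeInduce E₂).addEdge (Sum.inr n) u v}) n
      (fun K => if Sum.inr n ∈ K.edgeSet then H else K) := by
  have hne := h.splitPart_ne (hn H hH)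
  have hE₁ := edgeSet_splitPart (u := u) (v := v) h.subset_left (hn H hH)
  have hE₂ := edgeSet_splitPart (u := u) (v := v) h.subset_right (hn H hH)
  have hi := h.inter_eq
  have hV₁ := vertexSet_splitPart (e := Sum.inr n) (hi.symm.subset.trans Set.inter_subset_left)
  have hV₂ := vertexSet_splitPart (e := Sum.inr n) (hi.symm.subset.trans Set.inter_subset_right)
  have hI₁ : ∀ f ∈ E₁, ∀ x, H.Inc f x → ((H.edgeInduce E₁).addEdge (Sum.inr n) u v).Inc f x :=
    fun f hf x hx => hx.splitPart hf (hn H hH)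
  have hI₂ : ∀ f ∈ E₂, ∀ x, H.Inc f x → ((H.edgeInduce E₂).addEdge (Sum.inr n) u v).Inc f x :=
    fun f hf x hx => hx.splitPart hf (hn H hH)
  have hJ₁ : ∀ x ∈ ({u, v} : Set α),
      ((H.edgeInduce E₁).addEdge (Sum.inr n) u v).Inc (Sum.inr n) x := fun x => inc_addEdge _
  have hJ₂ : ∀ x ∈ ({u, v} : Set α),
      ((H.edgeInduce E₂).addEdge (Sum.inr n) u v).Inc (Sum.inr n) x := fun x => inc_addEdge _
  have hW₁ : (H.edgeInduce E₁).vertexSet ⊆ H.vertexSet := vertexSet_edgeInduce_subset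
  have hW₂ : (H.edgeInduce E₂).vertexSet ⊆ H.vertexSet := vertexSet_edgeInduce_subset
  have hc : ∀ f ∈ H.edgeSet, f ∈ E₁ ∨ f ∈ E₂ := fun f hf => by rwa [← h.1.1.1] at hf
  have hd : ∀ f, f ∈ E₁ → f ∉ E₂ := fun _ hf => Set.disjoint_left.1 h.1.1.2 hf
  have hs₁ := h.subset_left
  have hs₂ := h.subset_right
  have hx₁ : ∀ f ∈ E₁, ∀ x, H.Inc f x → x ∈ (H.edgeInduce E₁).vertexSet :=
    fun f hf x hx => ⟨f, hf, hx⟩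
  have hx₂ : ∀ f ∈ E₂, ∀ x, H.Inc f x → x ∈ (H.edgeInduce E₂).vertexSet :=
    fun f hf x hx => ⟨f, hf, hx⟩
  -- The construction of the two parts is forgotten; the facts collected above about edges, vertices
  -- and incidences suffice.
  generalize (H.edgeInduce E₁).addEdge (Sum.inr n) u v = H₁ at *
  generalize (H.edgeInduce E₂).addEdge (Sum.inr n) u v = H₂ at *
  generalize (H.edgeInduce E₁).vertexSet = W₁ at *
  generalize (H.edgeInduce E₂).vertexSet = W₂ at *
  -- As `n` is fresh, containing it distinguishes the two new graphs from the untouched ones, which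
  -- `φ` fixes.
  have hn₁ : Sum.inr n ∈ H₁.edgeSet := hE₁ ▸ Set.mem_insert _ _
  have hn₂ : Sum.inr n ∈ H₂.edgeSet := hE₂ ▸ Set.mem_insert _ _
  have hmem : ∀ K, K ∈ (S \ {H}) ∪ {H₁, H₂} ↔ (K ∈ S ∧ K ≠ H) ∨ K = H₁ ∨ K = H₂ := by
    intro K; simp; tauto
  constructor
  · intro K hK
    grind
  · intro K hK
    grind
  · intro K hK x hx
    by_cases hKH : K = H
    · subst hKH
      obtain ⟨f, hf⟩ := hS K hK x hx
      rcases hc f hf.edge_mem with h' | h'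
      · exact ⟨H₁, by simp, by simp [hn₁], hV₁ ▸ hx₁ f h' x hf⟩
      · exact ⟨H₂, by simp, by simp [hn₂], hV₂ ▸ hx₂ f h' x hf⟩
    · exact ⟨K, by simp [hK, hKH], by simp [hn K hK], hx⟩
  · intro K hK f hf hfn
    grind
  · intro K hK f hf
    by_cases hKH : K = H
    · subst hKH
      rcases hc f hf with h' | h'
      · exact ⟨H₁, by simp, by simp [hn₁], hE₁ ▸ Or.inr h'⟩
      · exact ⟨H₂, by simp, by simp [hn₂], hE₂ ▸ Or.inr h'⟩
    · exact ⟨K, by simp [hK, hKH], by simp [hn K hK], hf⟩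
  · intro K hK f hf x hx
    have := hx.edge_mem
    rcases (hmem K).1 hK with ⟨hK, -⟩ | rfl | rfl
    · simpa [hn K hK] using hx
    · simp only [hn₁, if_true] at hx this
      rw [hE₁] at hf
      rcases hf with rfl | hf
      · exact absurd this (hn H hH)
      · exact hI₁ f hf x hx
    · simp only [hn₂, if_true] at hx this
      rw [hE₂] at hf
      rcases hf with rfl | hf
      · exact absurd this (hn H hH)
      · exact hI₂ f hf x hx
  · exact hn
  · refine ⟨H₁, H₂, hne, by simp [hn₁, hn₂], ?_⟩
    ext K
    simp only [Set.mem_insert_iff, Set.mem_singleton_iff, hmem]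
    grind
  · intro K hK K' hK' hKK'
    grind
  · intro K hK K' hK' hKK' f hf hf' hfn
    rw [hmem] at hK hK'
    grind
  · intro K hK K' hK' hKK' hnK hnK' x hx hx'
    have hxuv : x ∈ W₁ → x ∈ W₂ → x ∈ ({u, v} : Set α) := fun h h' => hi ▸ ⟨h, h'⟩
    rw [hmem] at hK hK'
    grind

/-! ### Preservation of the tree property -/

section SplitMap

variable {S S' : Set (Graph α (β ⊕ ℕ))} {n : ℕ} {φ : Graph α (β ⊕ ℕ) → Graph α (β ⊕ ℕ)}

/-- For the new edge this holds because the parts meet only in the separating pair. An old edge lies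
in only one part of a split graph, so `A` and `B` have different images and the old invariant
applies to those. -/
theorem IsSplitMap.inc_of_mem (h : IsSplitMap S S' n φ) (hS : IsSplitCollection S)
    {A B : Graph α (β ⊕ ℕ)} (hA : A ∈ S') (hB : B ∈ S') (hAB : A ≠ B) {m : ℕ}
    (hmA : Sum.inr m ∈ A.edgeSet) (hmB : Sum.inr m ∈ B.edgeSet) {x : α}
    (hxA : x ∈ A.vertexSet) (hxB : x ∈ B.vertexSet) : A.Inc (Sum.inr m) x := by
  by_cases hmn : m = n
  · subst hmn
    exact h.inc_new A hA B hB hAB hmA hmB x hxA hxB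
  · have hmn' : (Sum.inr m : β ⊕ ℕ) ≠ Sum.inr n := fun h => hmn (Sum.inr.inj h)
    refine h.inc A hA _ hmA x (hS.inc_of_mem (φ A) (h.map_mem A hA) (φ B) (h.map_mem B hB) ?_ m
      (h.edge_mem A hA _ hmA hmn') (h.edge_mem B hB _ hmB hmn') x
      (h.vertexSet_subset A hA hxA) (h.vertexSet_subset B hB hxB))
    exact fun heq => hAB (h.eq_of_edge A hA B hB heq _ hmA hmB hmn')

/-- Links of the RMT-tree lift along a split map. -/
theorem IsSplitMap.exists_isLink (h : IsSplitMap S S' n φ) {m : ℕ} {A B : Graph α (β ⊕ ℕ)}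
    (hl : (rmtTree S).IsLink m A B) :
    ∃ A' B', φ A' = A ∧ φ B' = B ∧ (rmtTree S').IsLink m A' B' := by
  have hset : {C ∈ S | Sum.inr m ∈ C.edgeSet} = {A, B} := hl
  have hA : A ∈ {C ∈ S | Sum.inr m ∈ C.edgeSet} := hset ▸ Or.inl rfl
  have hB : B ∈ {C ∈ S | Sum.inr m ∈ C.edgeSet} := hset ▸ Or.inr rfl
  obtain ⟨A', hA', rfl, hmA⟩ := h.exists_edge A hA.1 _ hA.2
  obtain ⟨B', hB', rfl, hmB⟩ := h.exists_edge B hB.1 _ hB.2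
  have hmn : (Sum.inr m : β ⊕ ℕ) ≠ Sum.inr n := fun hm => h.fresh _ hA.1 (hm ▸ hA.2)
  refine ⟨A', B', rfl, rfl, Set.Subset.antisymm ?_ ?_⟩
  · rintro C ⟨hC, hmC⟩
    have : φ C ∈ ({φ A', φ B'} : Set _) := hset ▸ ⟨h.map_mem C hC, h.edge_mem C hC _ hmC hmn⟩
    rcases this with hCA | hCB
    · exact Or.inl (h.eq_of_edge C hC A' hA' hCA _ hmC hmA hmn)
    · exact Or.inr (h.eq_of_edge C hC B' hB' hCB _ hmC hmB hmn)
  · rintro C (rfl | rfl)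
    exacts [⟨hA', hmA⟩, ⟨hB', hmB⟩]

/-- Links of the RMT-tree other than the new one map along a split map. -/
theorem IsSplitMap.map_isLink (h : IsSplitMap S S' n φ) {m : ℕ} (hm : m ≠ n)
    {A B : Graph α (β ⊕ ℕ)} (hl : (rmtTree S').IsLink m A B) :
    (rmtTree S).IsLink m (φ A) (φ B) := by
  have hset : {C ∈ S' | Sum.inr m ∈ C.edgeSet} = {A, B} := hl
  have hmn : (Sum.inr m : β ⊕ ℕ) ≠ Sum.inr n := fun h => hm (Sum.inr.inj h)
  have hA : A ∈ {C ∈ S' | Sum.inr m ∈ C.edgeSet} := hset ▸ Or.inl rfl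
  have hB : B ∈ {C ∈ S' | Sum.inr m ∈ C.edgeSet} := hset ▸ Or.inr rfl
  refine Set.Subset.antisymm ?_ ?_
  · rintro C ⟨hC, hmC⟩
    obtain ⟨C', hC', rfl, hmC'⟩ := h.exists_edge C hC _ hmC
    have : C' ∈ ({A, B} : Set _) := hset ▸ ⟨hC', hmC'⟩
    rcases this with rfl | rfl
    exacts [Or.inl rfl, Or.inr rfl]
  · rintro C (rfl | rfl)
    exacts [⟨h.map_mem A hA.1, h.edge_mem A hA.1 _ hA.2 hmn⟩,
      ⟨h.map_mem B hB.1, h.edge_mem B hB.1 _ hB.2 hmn⟩]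

variable {v : α}

/-- A fibre of `φ` is a single brick, or two bricks joined by `n`, hence connected. -/
theorem IsSplitMap.connected_restrictedRMTTree (h : IsSplitMap S S' n φ)
    (hS : IsSplitCollection S) (hc : (restrictedRMTTree S v).toSimpleGraph.Connected) :
    (restrictedRMTTree S' v).toSimpleGraph.Connected := by
  let ψ : (restrictedRMTTree S' v).vertexSet → (restrictedRMTTree S v).vertexSet :=
    fun K => ⟨φ K.1, h.map_mem _ K.2.1, h.vertexSet_subset _ K.2.1 K.2.2⟩
  refine hc.of_surjective ψ ?_ ?_ ?_
  · rintro ⟨K, hK, hv⟩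
    obtain ⟨K', hK', rfl, hv'⟩ := h.exists_vertex K hK v hv
    exact ⟨⟨K', hK', hv'⟩, rfl⟩
  · rintro ⟨A, hA, hvA⟩ ⟨B, hB, hvB⟩ heq
    by_cases hAB : A = B
    · subst hAB
      exact .rfl
    obtain hAB' | ⟨hnA, hnB⟩ := h.eq_or_new A hA B hB (congrArg Subtype.val heq)
    · exact absurd hAB' hAB
    refine SimpleGraph.Adj.reachable ⟨fun h => hAB (congrArg Subtype.val h), n, ?_, ⟨hA, hvA⟩,
      ⟨hB, hvB⟩⟩
    obtain ⟨C, D, -, -, hset⟩ := h.exists_pair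
    have hA' : A ∈ ({C, D} : Set _) := hset ▸ ⟨hA, hnA⟩
    have hB' : B ∈ ({C, D} : Set _) := hset ▸ ⟨hB, hnB⟩
    refine hset.trans ?_
    rcases hA' with rfl | rfl <;> rcases hB' with rfl | rfl
    exacts [absurd rfl hAB, rfl, Set.pair_comm _ _, absurd rfl hAB]
  · rintro ⟨A, hA, hvA⟩ ⟨B, hB, hvB⟩ ⟨hne, m, hl, -, -⟩
    have hAB : A ≠ B := fun h => hne (Subtype.ext h)
    obtain ⟨A', B', rfl, rfl, hl'⟩ := h.exists_isLink hl
    have hset : {C ∈ S | Sum.inr m ∈ C.edgeSet} = {φ A', φ B'} := hl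
    have hset' : {C ∈ S' | Sum.inr m ∈ C.edgeSet} = {A', B'} := hl'
    have hmA : φ A' ∈ {C ∈ S | Sum.inr m ∈ C.edgeSet} := hset ▸ Or.inl rfl
    have hmB : φ B' ∈ {C ∈ S | Sum.inr m ∈ C.edgeSet} := hset ▸ Or.inr rfl
    have hmA' : A' ∈ {C ∈ S' | Sum.inr m ∈ C.edgeSet} := hset' ▸ Or.inl rfl
    have hmB' : B' ∈ {C ∈ S' | Sum.inr m ∈ C.edgeSet} := hset' ▸ Or.inr rfl
    -- Since `v` is an end of `m` in the old graph, it is also one in the part that inherits `m`.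
    have hvA' := (h.inc A' hmA'.1 _ hmA'.2 v
      (hS.inc_of_mem _ hA _ hB hAB m hmA.2 hmB.2 v hvA hvB)).vertex_mem
    have hvB' := (h.inc B' hmB'.1 _ hmB'.2 v
      (hS.inc_of_mem _ hB _ hA hAB.symm m hmB.2 hmA.2 v hvB hvA)).vertex_mem
    refine ⟨⟨A', hmA'.1, hvA'⟩, ⟨B', hmB'.1, hvB'⟩, rfl, rfl, SimpleGraph.Adj.reachable
      ⟨fun h => hAB (congrArg (fun K => φ K.1) h), m, hl', ⟨hmA'.1, hvA'⟩, ⟨hmB'.1, hvB'⟩⟩⟩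

theorem IsSplitMap.edgeSet_restrictedRMTTree_subset (h : IsSplitMap S S' n φ) :
    (restrictedRMTTree S' v).edgeSet ⊆ insert n (restrictedRMTTree S v).edgeSet := by
  rintro m ⟨A, B, hl, hA, hB⟩
  by_cases hm : m = n
  · exact Or.inl hm
  · exact Or.inr ⟨φ A, φ B, h.map_isLink hm hl,
      ⟨h.map_mem A hA.1, h.vertexSet_subset A hA.1 hA.2⟩,
      ⟨h.map_mem B hB.1, h.vertexSet_subset B hB.1 hB.2⟩⟩

/-- At most the edge `n` is gained. If it is, both its ends contain `v` and have the same image, so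
a node is gained too. -/
theorem IsSplitMap.encard_restrictedRMTTree_le (h : IsSplitMap S S' n φ)
    (hle : (restrictedRMTTree S v).edgeSet.encard + 1 ≤
      (restrictedRMTTree S v).vertexSet.encard) :
    (restrictedRMTTree S' v).edgeSet.encard + 1 ≤
      (restrictedRMTTree S' v).vertexSet.encard := by
  have himg : ∀ X : Set (Graph α (β ⊕ ℕ)),
      (∀ K ∈ S, v ∈ K.vertexSet → ∃ K' ∈ X, φ K' = K) →
      (restrictedRMTTree S v).vertexSet.encard ≤ X.encard := by
    intro X hX
    refine (Set.encard_le_encard ?_).trans (Set.encard_image_le φ X)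
    rintro K ⟨hK, hv⟩
    exact hX K hK hv
  by_cases hn : n ∈ (restrictedRMTTree S' v).edgeSet
  · obtain ⟨A, B, hAB, hφ, hset⟩ := h.exists_pair
    obtain ⟨C, D, hl, hC, hD⟩ := hn
    have hset' : {K ∈ S' | Sum.inr n ∈ K.edgeSet} = {C, D} := hl
    have hAB' : A ∈ (restrictedRMTTree S' v).vertexSet ∧
        B ∈ (restrictedRMTTree S' v).vertexSet := by
      have hA : A ∈ ({C, D} : Set _) := hset' ▸ hset ▸ Or.inl rfl
      have hB : B ∈ ({C, D} : Set _) := hset' ▸ hset ▸ Or.inr rfl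
      constructor
      · rcases hA with rfl | rfl
        exacts [hC, hD]
      · rcases hB with rfl | rfl
        exacts [hC, hD]
    -- Omitting `A` keeps `φ` onto the old nodes, since `B` has the same image.
    have h1 := himg ((restrictedRMTTree S' v).vertexSet \ {A}) (by
      intro K hK hv
      obtain ⟨K', hK', rfl, hv'⟩ := h.exists_vertex K hK v hv
      by_cases hKA : K' = A
      · exact ⟨B, ⟨hAB'.2, hAB.symm⟩, by rw [hKA, hφ]⟩
      · exact ⟨K', ⟨⟨hK', hv'⟩, hKA⟩, rfl⟩)
    calc _ ≤ ((restrictedRMTTree S v).edgeSet.encard + 1) + 1 := by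
          gcongr
          exact (Set.encard_le_encard h.edgeSet_restrictedRMTTree_subset).trans
            (Set.encard_insert_le _ _)
      _ ≤ ((restrictedRMTTree S' v).vertexSet \ {A}).encard + 1 := by
          gcongr
          exact hle.trans h1
      _ = _ := Set.encard_sdiff_singleton_add_one hAB'.1
  · have hsub : (restrictedRMTTree S' v).edgeSet ⊆ (restrictedRMTTree S v).edgeSet := by
      intro m hm
      rcases h.edgeSet_restrictedRMTTree_subset hm with rfl | hm'
      exacts [absurd hm hn, hm']
    calc _ ≤ (restrictedRMTTree S v).edgeSet.encard + 1 := by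
          gcongr
      _ ≤ _ := hle
      _ ≤ _ := himg _ (by
          intro K hK hv
          obtain ⟨K', hK', rfl, hv'⟩ := h.exists_vertex K hK v hv
          exact ⟨K', ⟨hK', hv'⟩, rfl⟩)

end SplitMap

theorem SplitStep.exists_isSplitMap {S S' : Set (Graph α (β ⊕ ℕ))} (h : SplitStep S S')
    (hS : IsSplitCollection S) : ∃ n φ, IsSplitMap S S' n φ := by
  obtain ⟨H, hH, E₁, E₂, u, v, n, hc, hn, rfl⟩ := h
  exact ⟨n, _, hc.isSplitMap hS.exists_inc hH hn⟩

theorem SplitStep.isSplitCollection {S S' : Set (Graph α (β ⊕ ℕ))} (h : SplitStep S S')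
    (hS : IsSplitCollection S) : IsSplitCollection S' := by
  obtain ⟨n', φ, hφ⟩ := h.exists_isSplitMap hS
  obtain ⟨H, hH, E₁, E₂, u, v, n, hc, hn, rfl⟩ := h
  refine ⟨(hS.finite.subset Set.sdiff_subset).union (Set.toFinite _), ?_, ?_, ?_⟩
  · rintro K (hK | rfl | rfl)
    · exact hS.finite_edgeSet K hK.1
    · rw [edgeSet_splitPart hc.subset_left (hn H hH)]
      exact ((hS.finite_edgeSet H hH).subset hc.subset_left).insert _
    · rw [edgeSet_splitPart hc.subset_right (hn H hH)]
      exact ((hS.finite_edgeSet H hH).subset hc.subset_right).insert _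
  · rintro K (hK | rfl | rfl) x hx
    · exact hS.exists_inc K hK.1 x hx
    all_goals
      rcases hx with ⟨f, hf, hx⟩ | hx
      · exact ⟨f, hx.splitPart hf (hn H hH)⟩
      · exact ⟨_, inc_addEdge _ hx⟩
  · exact fun A hA B hB hAB m hmA hmB x hxA hxB =>
      hφ.inc_of_mem hS hA hB hAB hmA hmB hxA hxB

/-! ### Termination -/

/-- A measure of a collection of graphs which decreases with each split operation. -/
noncomputable def splitMeasure (S : Set (Graph α β)) : ℕ :=
  ∑ᶠ H ∈ S, (H.edgeSet.ncard - 2) ^ 2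

/-- The excess |E| - 2 is additive under a split, the virtual edge being counted twice. Both new
excesses are at least 1, as each part has at least two old edges, so the sum of squares drops
strictly. -/
theorem SplitStep.splitMeasure_lt {S S' : Set (Graph α (β ⊕ ℕ))} (h : SplitStep S S')
    (hS : IsSplitCollection S) : splitMeasure S' < splitMeasure S := by
  obtain ⟨H, hH, E₁, E₂, u, v, n, hc, hn, rfl⟩ := h
  have hne := hc.splitPart_ne (hn H hH)
  have hE₁ := edgeSet_splitPart (u := u) (v := v) hc.subset_left (hn H hH)
  have hE₂ := edgeSet_splitPart (u := u) (v := v) hc.subset_right (hn H hH)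
  generalize (H.edgeInduce E₁).addEdge (Sum.inr n) u v = H₁ at *
  generalize (H.edgeInduce E₂).addEdge (Sum.inr n) u v = H₂ at *
  have hf₁ := (hS.finite_edgeSet H hH).subset hc.subset_left
  have hf₂ := (hS.finite_edgeSet H hH).subset hc.subset_right
  have hfin : (S \ {H}).Finite := hS.finite.subset Set.sdiff_subset
  have hnot : ∀ K, Sum.inr n ∈ K.edgeSet → K ∉ S \ {H} := fun K hK h => hn K h.1 hK
  have hH₁ : H₁ ∉ insert H₂ (S \ {H}) := by
    rintro (h | h)
    · exact hne h
    · exact hnot H₁ (hE₁ ▸ Set.mem_insert _ _) h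
  have hH₂ : H₂ ∉ S \ {H} := hnot H₂ (hE₂ ▸ Set.mem_insert _ _)
  have hS' : (S \ {H}) ∪ {H₁, H₂} = insert H₁ (insert H₂ (S \ {H})) := by
    ext K; simp
  have hS₀ : S = insert H (S \ {H}) := by
    rw [Set.insert_sdiff_singleton, Set.insert_eq_of_mem hH]
  have hm : splitMeasure S = (H.edgeSet.ncard - 2) ^ 2 + splitMeasure (S \ {H}) := by
    conv_lhs => rw [hS₀]
    exact finsum_mem_insert _ (by simp) hfin
  have hm' : splitMeasure (insert H₁ (insert H₂ (S \ {H}))) =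
      (H₁.edgeSet.ncard - 2) ^ 2 + ((H₂.edgeSet.ncard - 2) ^ 2 + splitMeasure (S \ {H})) := by
    rw [splitMeasure, finsum_mem_insert _ hH₁ (hfin.insert _), finsum_mem_insert _ hH₂ hfin]
    rfl
  rw [hS', hm, hm', ← add_assoc]
  have h1 : H₁.edgeSet.ncard = E₁.ncard + 1 := by
    rw [hE₁]
    exact Set.ncard_insert_of_notMem (fun h => hn H hH (hc.subset_left h)) hf₁
  have h2 : H₂.edgeSet.ncard = E₂.ncard + 1 := by
    rw [hE₂]
    exact Set.ncard_insert_of_notMem (fun h => hn H hH (hc.subset_right h)) hf₂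
  have h0 : H.edgeSet.ncard = E₁.ncard + E₂.ncard := by
    rw [← hc.1.1.1]
    exact Set.ncard_union_eq hc.1.1.2 hf₁ hf₂
  have g1 : 2 ≤ E₁.ncard := by
    have := hc.1.2.1
    rw [← hf₁.cast_ncard_eq] at this
    exact_mod_cast this
  have g2 : 2 ≤ E₂.ncard := by
    have := hc.1.2.2.1
    rw [← hf₂.cast_ncard_eq] at this
    exact_mod_cast this
  obtain ⟨a, ha⟩ := Nat.exists_eq_add_of_le g1
  obtain ⟨b, hb⟩ := Nat.exists_eq_add_of_le g2
  rw [h0, h1, h2, ha, hb]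
  gcongr
  rw [show 2 + a + 1 - 2 = a + 1 by omega, show 2 + b + 1 - 2 = b + 1 by omega,
    show 2 + a + (2 + b) - 2 = (a + 1) + (b + 1) by omega]
  nlinarith [Nat.zero_le (a * b)]

theorem IsSplitCollection.exists_fresh {S : Set (Graph α (β ⊕ ℕ))} (hS : IsSplitCollection S) :
    ∃ n : ℕ, ∀ K ∈ S, Sum.inr n ∉ K.edgeSet := by
  have hfin : (⋃ K ∈ S, K.edgeSet).Finite := hS.finite.biUnion hS.finite_edgeSet
  obtain ⟨n, hn⟩ := (hfin.preimage (Sum.inr_injective.injOn)).exists_notMem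
  exact ⟨n, fun K hK h => hn (Set.mem_biUnion hK h)⟩

/-- Split operations can be carried out until no split candidate is left. -/
theorem IsSplitCollection.exists_terminal {S : Set (Graph α (β ⊕ ℕ))}
    (hS : IsSplitCollection S) : ∃ S', Relation.ReflTransGen SplitStep S S' ∧
      ∀ H ∈ S', ∀ E₁ E₂ u v, ¬ H.IsSplitCandidate E₁ E₂ u v := by
  induction hm : splitMeasure S using Nat.strong_induction_on generalizing S with
  | _ m ih =>
    by_cases hex : ∃ H ∈ S, ∃ E₁ E₂ u v, H.IsSplitCandidate E₁ E₂ u v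
    · obtain ⟨H, hH, E₁, E₂, u, v, hc⟩ := hex
      obtain ⟨n, hn⟩ := hS.exists_fresh
      have hstep : SplitStep S _ := ⟨H, hH, E₁, E₂, u, v, n, hc, hn, rfl⟩
      obtain ⟨S', hS', ht⟩ := ih _ (hm ▸ hstep.splitMeasure_lt hS) (hstep.isSplitCollection hS) rfl
      exact ⟨S', .head hstep hS', ht⟩
    · push Not at hex
      exact ⟨S, .refl, hex⟩

/-! ### The initial collection -/

/-- An isolated vertex would be lost in a split, because `edgeInduce` keeps only ends of edges. -/
theorem TwoConnected.exists_inc {G : Graph α β} (h : G.TwoConnected) {x : α}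
    (hx : x ∈ G.vertexSet) : ∃ e, G.Inc e x := by
  have hnt : G.vertexSet.Nontrivial :=
    Set.one_lt_encard_iff_nontrivial.1 (lt_of_lt_of_le (by norm_num) h.2.1)
  obtain ⟨y, hy, hyx⟩ := hnt.exists_ne x
  obtain ⟨w⟩ := h.1.preconnected ⟨x, hx⟩ ⟨y, hy⟩
  cases w with
  | nil => exact absurd rfl hyx
  | cons hadj _ =>
    obtain ⟨-, e, he⟩ := hadj
    exact ⟨e, he.inc_left⟩

theorem TwoConnected.isSplitCollection {G : Graph α β} (h : G.TwoConnected)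
    (hfin : G.edgeSet.Finite) : IsSplitCollection {G.realEdges} := by
  refine ⟨Set.finite_singleton _, ?_, ?_, ?_⟩
  · rintro _ rfl
    refine (hfin.image Sum.inl).subset ?_
    rintro _ ⟨x, y, e, rfl, he⟩
    exact ⟨e, he.edge_mem, rfl⟩
  · rintro _ rfl x hx
    obtain ⟨e, y, hy⟩ := h.exists_inc hx
    exact ⟨Sum.inl e, y, e, rfl, hy⟩
  · rintro _ rfl _ rfl hne
    exact absurd rfl hne

theorem restrictedRMTTree_singleton_realEdges (G : Graph α β) {v : α} (hv : v ∈ G.vertexSet) :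
    (restrictedRMTTree {G.realEdges} v).toSimpleGraph.Connected ∧
      (restrictedRMTTree {G.realEdges} v).edgeSet.encard + 1 ≤
        (restrictedRMTTree {G.realEdges} v).vertexSet.encard := by
  have hV : (restrictedRMTTree {G.realEdges} v).vertexSet = {G.realEdges} := by
    ext K
    refine ⟨fun h => h.1, ?_⟩
    rintro rfl
    exact ⟨rfl, hv⟩
  have hE : (restrictedRMTTree {G.realEdges} v).edgeSet = ∅ := by
    refine Set.eq_empty_of_forall_notMem ?_
    rintro m ⟨A, B, hl, -, -⟩
    have hset : {C ∈ ({G.realEdges} : Set (Graph α (β ⊕ ℕ))) | Sum.inr m ∈ C.edgeSet} = {A, B} := hl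
    have hA : A ∈ {C ∈ ({G.realEdges} : Set (Graph α (β ⊕ ℕ))) | Sum.inr m ∈ C.edgeSet} :=
      hset ▸ Or.inl rfl
    obtain ⟨rfl, x, y, e, he, -⟩ := hA
    exact Sum.inr_ne_inl he
  have hsub : Subsingleton (restrictedRMTTree {G.realEdges} v).vertexSet := by
    rw [hV]; infer_instance
  have hnon : Nonempty (restrictedRMTTree {G.realEdges} v).vertexSet := by
    rw [hV]; infer_instance
  refine ⟨⟨fun x y => ?_⟩, by simp [hV, hE]⟩
  rw [Subsingleton.elim x y]

end Graph

theorem mainTheorem4 {α β : Type*} (G : Graph α β) [G.Loopless] (hfin : G.edgeSet.Finite)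
    (h2 : G.TwoConnected) (h3 : 3 ≤ G.edgeSet.encard) (v : α) (hv : v ∈ G.vertexSet) :
    (∃ S, G.IsBrickDecomposition S) ∧
      ∀ S, G.IsBrickDecomposition S → (Graph.restrictedRMTTree S v).IsTree := by
  have h0 := h2.isSplitCollection hfin
  refine ⟨h0.exists_terminal, fun S hS => ?_⟩
  -- Acyclicity is not carried through the induction; the edge count stands in for it.
  have key : Graph.IsSplitCollection S ∧ (Graph.restrictedRMTTree S v).toSimpleGraph.Connected ∧
      (Graph.restrictedRMTTree S v).edgeSet.encard + 1 ≤
        (Graph.restrictedRMTTree S v).vertexSet.encard := by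
    obtain ⟨hS, -⟩ := hS
    induction hS with
    | refl => exact ⟨h0, Graph.restrictedRMTTree_singleton_realEdges G hv⟩
    | tail _ hstep ih =>
      obtain ⟨n, φ, hφ⟩ := hstep.exists_isSplitMap ih.1
      exact ⟨hstep.isSplitCollection ih.1, hφ.connected_restrictedRMTTree ih.1 ih.2.1,
        hφ.encard_restrictedRMTTree_le ih.2.2⟩
  exact Graph.isTree_of_connected_of_encard_lt key.2.1
    (key.1.finite.subset fun _ h => h.1) key.2.2
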